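/- For complex numbers $a,q$ with $|q|<1$ and an integer $m\ge 0$ write $(a;q)_m=\prod_{j=0}^{m-1}(1-aq^j)$, $(a;q)_\infty=\prod_{j=0}^{\infty}(1-aq^j)$ and $(a,b,c;q)_\infty=(a;q)_\infty(b;q)_\infty(c;q)_\infty$. Then for every complex $q$ with $|q|<1$ the following two double series converge absolutely and $$\sum_{n,r\ge 0}\frac{q^{3n^2+6nr+6r^2}\,(q;q)_{3r}}{(q^3;q^3)_{2r}\,(q^3;q^3)_r\,(q^3;q^3)_n}=\frac{(q^7,q^8,q^{15};q^{15})_\infty}{(q^3;q^3)_\infty},$$ $$\sum_{n,r\ge 0}\frac{q^{3n^2+6nr+6r^2+3n+6r}\,(q;q)_{3r+1}}{(q^3;q^3)_{2r+1}\,(q^3;q^3)_r\,(q^3;q^3)_n}=\frac{(q,q^{14},q^{15};q^{15})_\infty}{(q^3;q^3)_\infty}.$$ -/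

import Mathlib

/-- The finite `q`-shifted factorial `(a; q)_m = ∏_{j=0}^{m-1} (1 - a q^j)`. -/
noncomputable def qPoch (a q : ℂ) (m : ℕ) : ℂ :=
  ∏ j ∈ Finset.range m, (1 - a * q ^ j)

/-- The infinite `q`-shifted factorial `(a; q)_∞ = ∏_{j=0}^∞ (1 - a q^j)`; the product converges
absolutely for `‖q‖ < 1`, see `multipliable_qPochInf`. -/
noncomputable def qPochInf (a q : ℂ) : ℂ :=
  ∏' j : ℕ, (1 - a * q ^ j)

/-- The infinite product that defines `(a; q)_∞` converges for every `a` as soon as `‖q‖ < 1`. -/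
theorem multipliable_qPochInf (a q : ℂ) (hq : ‖q‖ < 1) :
    Multipliable fun j : ℕ => 1 - a * q ^ j := by
  have h : Summable fun j : ℕ => ‖-(a * q ^ j)‖ := by
    simp only [norm_neg, norm_mul, norm_pow]
    exact (summable_geometric_of_lt_one (norm_nonneg q) hq).mul_left ‖a‖
  simpa [sub_eq_add_neg] using multipliable_one_add_of_summable h

/-- The abbreviation `(a, b, c; q)_∞ = (a; q)_∞ (b; q)_∞ (c; q)_∞`. -/
noncomputable def qPochInf₃ (a b c q : ℂ) : ℂ :=
  qPochInf a q * qPochInf b q * qPochInf c q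

open Filter Topology
open Finset (HasAntidiagonal)

/-! Put Q = q^3, x = q, y = q^2, so xy = Q. Splitting exponents mod 3 turns the numerator over
(Q;Q)_r into (x;Q)_(r+e) (y;Q)_r, with e = 0 or 1 for the two series. The finite Jacobi identity
`hasSum_finite_jacobi` expands this, divided by (Q;Q)_(2r+e), as a theta sum over k with
coefficients 1/((Q;Q)_(r+k) (Q;Q)_(r+e-k)): a Bailey pair.

Absolute convergence lets the sum over k move outside. For fixed k the sum over (n,r) is then two
steps of a Bailey chain: q-Chu–Vandermonde on n + r = const, then Cauchy's identity. It yields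
Q^(2(k^2-ek))/(Q;Q)_∞ (`hasSum_bailey`). The remaining theta series in k is a Jacobi triple product
with base q^15. -/

theorem HasSum.of_eq {ι : Type*} {f g : ι → ℂ} {a b : ℂ} (h : HasSum f a) (hf : ∀ i, g i = f i)
    (hb : b = a) : HasSum g b := by
  rw [hb, funext hf]
  exact h

/-! ### q-shifted factorials and their reciprocals. -/

theorem qPoch_succ (a q : ℂ) (m : ℕ) : qPoch a q (m + 1) = qPoch a q m * (1 - a * q ^ m) :=
  Finset.prod_range_succ _ _

theorem one_sub_pow_ne_zero {q : ℂ} (hq : ‖q‖ < 1) {m : ℕ} (hm : m ≠ 0) : 1 - q ^ m ≠ 0 := by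
  intro h
  have h1 : ‖q ^ m‖ < 1 := by
    rw [norm_pow]
    exact pow_lt_one₀ (norm_nonneg q) hq hm
  rw [← sub_eq_zero.1 h, norm_one] at h1
  exact lt_irrefl _ h1

theorem qPoch_self_ne_zero {q : ℂ} (hq : ‖q‖ < 1) (m : ℕ) : qPoch q q m ≠ 0 := by
  refine Finset.prod_ne_zero_iff.2 fun j _ => ?_
  rw [← pow_succ']
  exact one_sub_pow_ne_zero hq j.succ_ne_zero

theorem qPochInf_self_ne_zero {q : ℂ} (hq : ‖q‖ < 1) : qPochInf q q ≠ 0 := by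
  have h := tprod_one_add_ne_zero_of_summable (f := fun j : ℕ => -(q * q ^ j)) (fun j => ?_) ?_
  · simpa [qPochInf, sub_eq_add_neg] using h
  · rw [← sub_eq_add_neg, ← pow_succ']
    exact one_sub_pow_ne_zero hq j.succ_ne_zero
  · simp only [norm_neg, norm_mul, norm_pow]
    exact (summable_geometric_of_lt_one (norm_nonneg q) hq).mul_left ‖q‖

theorem tendsto_qPoch (a : ℂ) {q : ℂ} (hq : ‖q‖ < 1) :
    Tendsto (qPoch a q) atTop (𝓝 (qPochInf a q)) :=
  (multipliable_qPochInf a q hq).hasProd.tendsto_prod_nat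

/-- The reciprocal `1 / (q; q)_n` of the `q`-factorial, extended by zero to negative `n`. -/
noncomputable def qFacInv (q : ℂ) (n : ℤ) : ℂ :=
  if 0 ≤ n then (qPoch q q n.toNat)⁻¹ else 0

theorem qFacInv_natCast (q : ℂ) (n : ℕ) : qFacInv q n = (qPoch q q n)⁻¹ := by
  simp [qFacInv]

theorem qFacInv_of_neg (q : ℂ) {n : ℤ} (hn : n < 0) : qFacInv q n = 0 := by
  simp [qFacInv, hn]

theorem qFacInv_zero (q : ℂ) : qFacInv q 0 = 1 := by
  simp [qFacInv, qPoch]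

theorem qFacInv_eq_mul_succ {q : ℂ} (hq : ‖q‖ < 1) (n : ℤ) :
    qFacInv q n = (1 - q ^ (n + 1).toNat) * qFacInv q (n + 1) := by
  rcases lt_or_ge n 0 with hn | hn
  · rw [qFacInv_of_neg q hn, Int.toNat_of_nonpos (by lia)]
    simp
  · lift n to ℕ using hn
    have h : ((n : ℤ) + 1) = ((n + 1 : ℕ) : ℤ) := by push_cast; rfl
    rw [h, qFacInv_natCast, qFacInv_natCast, qPoch_succ, Int.toNat_natCast, ← pow_succ']
    have h1 := one_sub_pow_ne_zero hq n.succ_ne_zero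
    have h2 := qPoch_self_ne_zero hq n
    field_simp

theorem tendsto_qFacInv {q : ℂ} (hq : ‖q‖ < 1) (k : ℤ) :
    Tendsto (fun n : ℕ => qFacInv q (n + k)) atTop (𝓝 (qPochInf q q)⁻¹) := by
  have h1 : Tendsto (fun n : ℕ => (n : ℤ) + k) atTop atTop :=
    tendsto_atTop_add_const_right _ _ tendsto_natCast_atTop_atTop
  have h2 : Tendsto (fun n : ℤ => n.toNat) atTop atTop :=
    tendsto_atTop.2 fun b => (eventually_ge_atTop (b : ℤ)).mono fun n hn => by lia
  have h3 := ((tendsto_qPoch q hq).comp (h2.comp h1)).inv₀ (qPochInf_self_ne_zero hq)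
  refine h3.congr' ?_
  filter_upwards [h1.eventually_ge_atTop 0] with n hn
  simp [qFacInv, hn]

theorem exists_norm_qFacInv_le {q : ℂ} (hq : ‖q‖ < 1) :
    ∃ C : ℝ, 0 ≤ C ∧ ∀ n : ℤ, ‖qFacInv q n‖ ≤ C := by
  have h := Metric.isBounded_range_of_tendsto _ (tendsto_qFacInv hq 0)
  obtain ⟨C, hC⟩ := h.exists_norm_le
  have h0 : 0 ≤ C := (norm_nonneg _).trans (hC _ ⟨0, rfl⟩)
  refine ⟨C, h0, fun n => ?_⟩
  rcases lt_or_ge n 0 with hn | hn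
  · rwa [qFacInv_of_neg q hn, norm_zero]
  · lift n to ℕ using hn
    exact hC _ ⟨n, by simp⟩

/-! ### The Jacobi triple product, finite and infinite. -/

/-- The triangular number `k (k + 1) / 2` of an integer `k`. -/
def triangular (k : ℤ) : ℕ := (k * (k + 1) / 2).toNat

theorem two_mul_triangular (k : ℤ) : 2 * (triangular k : ℤ) = k * (k + 1) := by
  have h0 : 0 ≤ k * (k + 1) := by
    rcases lt_or_ge k 0 with h | h
    · exact mul_nonneg_of_nonpos_of_nonpos h.le (by lia)
    · positivity
  have h1 := Int.even_mul_succ_self k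
  rw [triangular, Int.toNat_of_nonneg (by lia), Int.two_mul_ediv_two_of_even h1]

/-- The general term of the two-variable theta series `∑ (-1)^k x^(k(k+1)/2) y^(k(k-1)/2)`. -/
noncomputable def thetaTerm (x y : ℂ) (k : ℤ) : ℂ :=
  (-1) ^ k.natAbs * x ^ triangular k * y ^ triangular (k - 1)

theorem triangular_neg (k : ℤ) : triangular (-k) = triangular (k - 1) := by
  unfold triangular
  congr 2
  ring

theorem thetaTerm_neg (x y : ℂ) (k : ℤ) : thetaTerm x y (-k) = thetaTerm y x k := by
  have h : triangular (-k - 1) = triangular k := by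
    rw [← triangular_neg, neg_neg]
  rw [thetaTerm, thetaTerm, triangular_neg, h, Int.natAbs_neg]
  ring

theorem thetaTerm_shift {x y q : ℂ} (hxy : x * y = q) (a : ℕ) (k : ℤ) (hk : k ≤ a + 1) :
    -x * q ^ a * thetaTerm x y (k - 1) = q ^ (a + 1 - k).toNat * thetaTerm x y k := by
  have hs : (-1 : ℂ) ^ k.natAbs = -(-1) ^ (k - 1).natAbs := by
    rcases Int.even_or_odd k with h | h
    · rw [(Int.natAbs_even.2 h).neg_one_pow, (Int.natAbs_odd.2 (h.sub_odd odd_one)).neg_one_pow]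
      simp
    · rw [(Int.natAbs_odd.2 h).neg_one_pow, (Int.natAbs_even.2 (h.sub_odd odd_one)).neg_one_pow]
  have h0 := two_mul_triangular k
  have h1 := two_mul_triangular (k - 1)
  have h2 := two_mul_triangular (k - 1 - 1)
  have e1 : 1 + a + triangular (k - 1) = (a + 1 - k).toNat + triangular k := by
    zify
    rw [Int.toNat_of_nonneg (by lia)]
    linarith
  have e2 : a + triangular (k - 1 - 1) = (a + 1 - k).toNat + triangular (k - 1) := by
    zify
    rw [Int.toNat_of_nonneg (by lia)]
    linarith
  rw [thetaTerm, thetaTerm, ← hxy, hs]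
  calc _ = -(-1) ^ (k - 1).natAbs * x ^ (1 + a + triangular (k - 1)) *
        y ^ (a + triangular (k - 1 - 1)) := by ring
    _ = _ := by rw [e1, e2]; ring

/-- Split 1 - q^(u+v) = (1 - q^u) + q^u (1 - q^v) with u = b + 1, v = a; each piece cancels the last
factor of one q-factorial. -/
theorem qFacInv_pascal {q : ℂ} (hq : ‖q‖ < 1) (a b : ℤ) (m : ℕ) (hm : a + b + 1 = m) :
    (1 - q ^ m) * (qFacInv q a * qFacInv q (b + 1)) =
      qFacInv q a * qFacInv q b +
        q ^ (b + 1).toNat * (qFacInv q (a - 1) * qFacInv q (b + 1)) := by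
  rcases lt_or_ge (b + 1) 0 with hb | hb
  · simp [qFacInv_of_neg q hb, qFacInv_of_neg q (show b < 0 by lia)]
  rcases lt_or_ge a 0 with ha | ha
  · simp [qFacInv_of_neg q ha, qFacInv_of_neg q (show a - 1 < 0 by lia)]
  have h : m = (b + 1).toNat + a.toNat := by lia
  rw [qFacInv_eq_mul_succ hq b, qFacInv_eq_mul_succ hq (a - 1), sub_add_cancel, h, pow_add]
  ring

theorem hasSum_finite_jacobi_step {x y q : ℂ} (hq : ‖q‖ < 1) (hxy : x * y = q) (a b : ℕ)
    (h : HasSum (fun k : ℤ => thetaTerm x y k * (qFacInv q (b + k) * qFacInv q (a - k)))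
      (qPoch x q a * qPoch y q b * qFacInv q (a + b))) :
    HasSum (fun k : ℤ => thetaTerm x y k * (qFacInv q (b + k) * qFacInv q ((a + 1 : ℕ) - k)))
      (qPoch x q (a + 1) * qPoch y q b * qFacInv q ((a + 1 : ℕ) + b)) := by
  have hne : 1 - q ^ (a + b + 1) ≠ 0 := one_sub_pow_ne_zero hq (a + b).succ_ne_zero
  have h1 := ((Equiv.subRight (1 : ℤ)).hasSum_iff.2 h).mul_left (-x * q ^ a)
  have h2 := (h.add h1).mul_left (1 - q ^ (a + b + 1))⁻¹
  refine h2.of_eq (fun k => ?_) ?_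
  · rw [eq_inv_mul_iff_mul_eq₀ hne]
    have hp := qFacInv_pascal hq (b + k) (a - k) (a + b + 1) (by push_cast; ring)
    have e1 : ((a + 1 : ℕ) : ℤ) - k = a - k + 1 := by push_cast; ring
    have e2 : (a : ℤ) - (k - 1) = a - k + 1 := by ring
    have e3 : (b : ℤ) + (k - 1) = b + k - 1 := by ring
    simp only [Function.comp_apply, Equiv.subRight_apply]
    rw [e1, e2, e3, mul_left_comm, hp, mul_add, ← mul_assoc (-x * q ^ a)]
    congr 1
    -- `thetaTerm_shift` needs k ≤ a + 1; beyond that the reciprocal factorial vanishes.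
    rcases lt_or_ge ((a : ℤ) - k + 1) 0 with hk | hk
    · simp [qFacInv_of_neg q hk]
    · rw [thetaTerm_shift hxy a k (by lia), show (a : ℤ) - k + 1 = a + 1 - k by ring]
      ring
  · rw [eq_inv_mul_iff_mul_eq₀ hne, qFacInv_eq_mul_succ hq (a + b), qPoch_succ]
    have e1 : ((a + 1 : ℕ) : ℤ) + b = a + b + 1 := by push_cast; ring
    have e2 : ((a : ℤ) + b + 1).toNat = a + b + 1 := by lia
    rw [e1, e2]
    ring

/-- The reflection k ↦ -k swaps (x, a) with (y, b), so the induction step in a also serves for b. -/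
theorem hasSum_finite_jacobi_symm {x y q : ℂ} {a b : ℕ}
    (h : HasSum (fun k : ℤ => thetaTerm x y k * (qFacInv q (b + k) * qFacInv q (a - k)))
      (qPoch x q a * qPoch y q b * qFacInv q (a + b))) :
    HasSum (fun k : ℤ => thetaTerm y x k * (qFacInv q (a + k) * qFacInv q (b - k)))
      (qPoch y q b * qPoch x q a * qFacInv q (b + a)) := by
  refine ((Equiv.neg ℤ).hasSum_iff.2 h).of_eq (fun k => ?_) ?_
  · simp only [Function.comp_apply, Equiv.neg_apply, thetaTerm_neg, sub_neg_eq_add,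
      ← sub_eq_add_neg]
    ring
  · rw [add_comm (b : ℤ)]
    ring

/-- The finite form of the Jacobi triple product identity. -/
theorem hasSum_finite_jacobi {q : ℂ} (hq : ‖q‖ < 1) {x y : ℂ} (hxy : x * y = q) (a b : ℕ) :
    HasSum (fun k : ℤ => thetaTerm x y k * (qFacInv q (b + k) * qFacInv q (a - k)))
      (qPoch x q a * qPoch y q b * qFacInv q (a + b)) := by
  induction a generalizing b with
  | succ a ih => exact hasSum_finite_jacobi_step hq hxy a b (ih b)
  | zero =>
    induction b with
    | succ b ih =>
      exact hasSum_finite_jacobi_symm (hasSum_finite_jacobi_step hq ((mul_comm y x).trans hxy) b 0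
        (hasSum_finite_jacobi_symm ih))
    | zero =>
      convert hasSum_single (0 : ℤ) fun k hk => ?_ using 1
      · simp [qFacInv_zero, qPoch, thetaTerm, triangular]
      · rcases lt_or_gt_of_ne hk with h | h
        · simp [qFacInv_of_neg q h]
        · simp [qFacInv_of_neg q (neg_lt_zero.2 h)]

theorem summable_pow_natAbs {r : ℝ} (h0 : 0 ≤ r) (h1 : r < 1) :
    Summable fun k : ℤ => r ^ k.natAbs :=
  Summable.of_nat_of_neg (by simpa using summable_geometric_of_lt_one h0 h1)
    (by simpa using summable_geometric_of_lt_one h0 h1)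

theorem summable_norm_thetaTerm {x y : ℂ} (hx : ‖x‖ < 1) (hy : ‖y‖ < 1) :
    Summable fun k : ℤ => ‖thetaTerm x y k‖ := by
  have h0 : 0 ≤ max ‖x‖ ‖y‖ := (norm_nonneg x).trans (le_max_left _ _)
  have h1 : max ‖x‖ ‖y‖ < 1 := max_lt hx hy
  refine Summable.of_nonneg_of_le (fun _ => norm_nonneg _) (fun k => ?_)
    (summable_pow_natAbs h0 h1)
  have h2 := two_mul_triangular k
  have h3 := two_mul_triangular (k - 1)
  have h4 : k.natAbs ≤ triangular k + triangular (k - 1) := by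
    have h5 : ((triangular k + triangular (k - 1) : ℕ) : ℤ) = k ^ 2 := by
      push_cast
      linarith
    zify at h5 ⊢
    rw [h5, ← sq_abs]
    nlinarith [abs_nonneg k, Int.one_le_abs (z := k), eq_or_ne k 0, sq_nonneg (|k| - 1)]
  calc ‖thetaTerm x y k‖ = ‖x‖ ^ triangular k * ‖y‖ ^ triangular (k - 1) := by
        simp [thetaTerm]
    _ ≤ max ‖x‖ ‖y‖ ^ triangular k * max ‖x‖ ‖y‖ ^ triangular (k - 1) := by
        gcongr
        · exact le_max_left _ _
        · exact le_max_right _ _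
    _ = max ‖x‖ ‖y‖ ^ (triangular k + triangular (k - 1)) := (pow_add _ _ _).symm
    _ ≤ _ := pow_le_pow_of_le_one h0 h1.le h4

theorem tendsto_qFacInv_sub {q : ℂ} (hq : ‖q‖ < 1) (k : ℤ) :
    Tendsto (fun n : ℕ => qFacInv q (n - k)) atTop (𝓝 (qPochInf q q)⁻¹) := by
  simpa only [sub_eq_add_neg] using tendsto_qFacInv hq (-k)

/-- The Jacobi triple product identity. -/
theorem hasSum_jacobi {q x y : ℂ} (hq : ‖q‖ < 1) (hx : ‖x‖ < 1) (hy : ‖y‖ < 1)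
    (hxy : x * y = q) :
    HasSum (thetaTerm x y) (qPochInf₃ x y q q) := by
  obtain ⟨C, hC0, hC⟩ := exists_norm_qFacInv_le hq
  have hs := summable_norm_thetaTerm hx hy
  have hL := qPochInf_self_ne_zero hq
  -- Let a = b = n → ∞ in the finite form; boundedness of the reciprocal factorials gives the
  -- dominating series.
  have h1 := tendsto_tsum_of_dominated_convergence (𝓕 := atTop)
    (f := fun (n : ℕ) (k : ℤ) => thetaTerm x y k * (qFacInv q (n + k) * qFacInv q (n - k)))
    (hs.mul_right (C * C))
    (fun k => ((tendsto_qFacInv hq k).mul (tendsto_qFacInv_sub hq k)).const_mul (thetaTerm x y k))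
    (Eventually.of_forall fun n k => by
      rw [norm_mul, norm_mul]
      gcongr
      · exact hC _
      · exact hC _)
  have h2 : Tendsto (fun n : ℕ => qFacInv q (n + n)) atTop (𝓝 (qPochInf q q)⁻¹) := by
    have h3 := (tendsto_qFacInv hq 0).comp (tendsto_id.atTop_add_atTop (tendsto_id (α := ℕ)))
    refine h3.congr fun n => ?_
    simp
  have h4 := ((tendsto_qPoch x hq).mul (tendsto_qPoch y hq)).mul h2
  simp only [(hasSum_finite_jacobi hq hxy _ _).tsum_eq, tsum_mul_right] at h1
  have h5 := tendsto_nhds_unique h1 h4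
  refine hs.of_norm.hasSum.of_eq (fun _ => rfl) ?_
  rw [qPochInf₃]
  field_simp at h5
  linear_combination -h5

/-! ### q-Chu–Vandermonde and Cauchy's identity. -/

theorem qFacInv_cast_eq_mul_succ {q : ℂ} (hq : ‖q‖ < 1) (n : ℕ) :
    qFacInv q n = (1 - q ^ (n + 1)) * qFacInv q ((n + 1 : ℕ) : ℤ) := by
  rw [qFacInv_eq_mul_succ hq, show ((n : ℤ) + 1).toNat = n + 1 by lia, Nat.cast_succ]

/-- A form of the `q`-Chu–Vandermonde sum. -/
theorem sum_antidiagonal_qFacInv {q : ℂ} (hq : ‖q‖ < 1) (M d : ℕ) :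
    ∑ p ∈ HasAntidiagonal.antidiagonal M, q ^ (p.2 * (p.2 + d)) *
      (qFacInv q p.1 * qFacInv q p.2 * qFacInv q ((p.2 + d : ℕ) : ℤ)) =
    qFacInv q M * qFacInv q ((M + d : ℕ) : ℤ) := by
  induction M generalizing d with
  | zero => simp [qFacInv_zero]
  | succ M ih =>
    refine mul_left_cancel₀ (one_sub_pow_ne_zero hq (Nat.add_one_ne_zero M)) ?_
    -- From 1 - q^(i+j) = (1 - q^i) + q^i (1 - q^j) with i + j = M + 1; the two parts reduce to (M,
    -- d) and (M, d + 1), hence the induction over all d.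
    have key : ∀ p ∈ HasAntidiagonal.antidiagonal (M + 1),
        (1 - q ^ (M + 1)) * (q ^ (p.2 * (p.2 + d)) *
        (qFacInv q p.1 * qFacInv q p.2 * qFacInv q ((p.2 + d : ℕ) : ℤ))) =
        q ^ (p.2 * (p.2 + d)) *
          (qFacInv q (p.1 - 1) * qFacInv q p.2 * qFacInv q ((p.2 + d : ℕ) : ℤ)) +
        q ^ (p.2 * (p.2 + d) + p.1) *
          (qFacInv q p.1 * qFacInv q (p.2 - 1) * qFacInv q ((p.2 + d : ℕ) : ℤ)) := by
      intro p hp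
      rw [HasAntidiagonal.mem_antidiagonal] at hp
      rw [qFacInv_eq_mul_succ hq (p.1 - 1), qFacInv_eq_mul_succ hq (p.2 - 1), ← hp]
      simp only [sub_add_cancel, Int.toNat_natCast]
      ring
    rw [Finset.mul_sum, Finset.sum_congr rfl key, Finset.sum_add_distrib,
      Finset.Nat.sum_antidiagonal_succ, Finset.Nat.sum_antidiagonal_succ']
    simp only [Nat.cast_zero, zero_sub, qFacInv_of_neg q (show (-1 : ℤ) < 0 by lia), mul_zero,
      zero_mul, zero_add, Nat.cast_add, Nat.cast_one, add_sub_cancel_right]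
    have e : ∀ p ∈ HasAntidiagonal.antidiagonal M, q ^ ((p.2 + 1) * (p.2 + 1 + d) + p.1) *
        (qFacInv q p.1 * qFacInv q p.2 * qFacInv q ((p.2 : ℤ) + 1 + d)) =
        q ^ (M + 1 + d) * (q ^ (p.2 * (p.2 + (d + 1))) *
        (qFacInv q p.1 * qFacInv q p.2 * qFacInv q ((p.2 + (d + 1) : ℕ) : ℤ))) := by
      intro p hp
      rw [HasAntidiagonal.mem_antidiagonal] at hp
      rw [← hp, show (p.2 : ℤ) + 1 + d = ((p.2 + (d + 1) : ℕ) : ℤ) by push_cast; ring]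
      ring
    have h1 := ih d
    push_cast at h1
    rw [h1, Finset.sum_congr rfl e, ← Finset.mul_sum, ih (d + 1)]
    have h2 := qFacInv_cast_eq_mul_succ hq (M + d)
    have h3 := qFacInv_cast_eq_mul_succ hq M
    have e1 : (M : ℤ) + 1 + d = ((M + d + 1 : ℕ) : ℤ) := by push_cast; ring
    push_cast at h2 h3 e1 ⊢
    rw [e1, ← add_assoc (M : ℤ), h2, h3]
    ring

/-- Cauchy's identity `∑ q^(s(s+d)) / ((q; q)_s (q; q)_(s+d)) = 1 / (q; q)_∞`. -/
theorem hasSum_qFacInv_mul_qFacInv {q : ℂ} (hq : ‖q‖ < 1) (d : ℕ) :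
    HasSum (fun s : ℕ => q ^ (s * (s + d)) * (qFacInv q s * qFacInv q ((s + d : ℕ) : ℤ)))
      (qPochInf q q)⁻¹ := by
  obtain ⟨C, hC0, hC⟩ := exists_norm_qFacInv_le hq
  have hL := qPochInf_self_ne_zero hq
  have hg : Summable fun s : ℕ => ‖q‖ ^ s := summable_geometric_of_lt_one (norm_nonneg q) hq
  have hb : ∀ s : ℕ, ‖q‖ ^ (s * (s + d)) ≤ ‖q‖ ^ s := fun s =>
    pow_le_pow_of_le_one (norm_nonneg q) hq.le
      (by nlinarith [Nat.zero_le (s * d), Nat.le_mul_self s])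
  -- Let M → ∞ in q-Chu–Vandermonde; one factor 1/(q;q)_∞ then cancels.
  have h1 := tendsto_tsum_of_dominated_convergence (𝓕 := atTop)
    (f := fun (M s : ℕ) => q ^ (s * (s + d)) *
      (qFacInv q ((M : ℤ) - s) * (qFacInv q s * qFacInv q ((s + d : ℕ) : ℤ))))
    (hg.mul_right (C * (C * C)))
    (fun s => ((tendsto_qFacInv_sub hq s).mul_const _).const_mul _)
    (Eventually.of_forall fun n k => by
      rw [norm_mul, norm_mul, norm_mul, norm_pow]
      exact mul_le_mul (hb k) (mul_le_mul (hC _) (mul_le_mul (hC _) (hC _) (norm_nonneg _) hC0)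
        (by positivity) (by positivity)) (by positivity) (by positivity))
  have h2 : Tendsto (fun M : ℕ => qFacInv q M * qFacInv q ((M + d : ℕ) : ℤ)) atTop
      (𝓝 ((qPochInf q q)⁻¹ * (qPochInf q q)⁻¹)) := by
    simpa using (tendsto_qFacInv hq 0).mul (tendsto_qFacInv hq d)
  have h3 : ∀ M : ℕ, ∑' s : ℕ, q ^ (s * (s + d)) *
      (qFacInv q ((M : ℤ) - s) * (qFacInv q s * qFacInv q ((s + d : ℕ) : ℤ))) =
      qFacInv q M * qFacInv q ((M + d : ℕ) : ℤ) := by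
    intro M
    rw [tsum_eq_sum (s := Finset.range (M + 1)), ← sum_antidiagonal_qFacInv hq,
      ← Finset.Nat.sum_antidiagonal_swap, Finset.Nat.sum_antidiagonal_eq_sum_range_succ_mk]
    · refine Finset.sum_congr rfl fun s hs => ?_
      rw [Finset.mem_range] at hs
      simp only [Prod.fst_swap, Prod.snd_swap]
      rw [Nat.cast_sub (by lia), mul_assoc (qFacInv q _)]
    · intro s hs
      rw [Finset.mem_range] at hs
      rw [qFacInv_of_neg q (show (M : ℤ) - s < 0 by lia)]
      simp
  simp only [h3] at h1
  have h5 := tendsto_nhds_unique h1 h2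
  have hsum : Summable fun s : ℕ =>
      q ^ (s * (s + d)) * (qFacInv q s * qFacInv q ((s + d : ℕ) : ℤ)) := by
    refine (hg.mul_right (C * C)).of_norm_bounded fun s => ?_
    rw [norm_mul, norm_mul, norm_pow]
    exact mul_le_mul (hb s) (mul_le_mul (hC _) (hC _) (norm_nonneg _) hC0)
      (by positivity) (by positivity)
  refine hsum.hasSum.of_eq (fun _ => rfl) ?_
  simp only [mul_left_comm _ (qPochInf q q)⁻¹, tsum_mul_left] at h5
  exact (mul_left_cancel₀ (inv_ne_zero hL) h5).symm

/-! ### The Bailey chain and the interchange of sums. -/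

theorem HasSum.antidiagonal {f : ℕ × ℕ → ℂ} (hf : Summable f) {a : ℂ}
    (h : HasSum (fun M => ∑ p ∈ HasAntidiagonal.antidiagonal M, f p) a) : HasSum f a := by
  have h1 := HasAntidiagonal.sigmaAntidiagonalEquivProd.hasSum_iff.2 hf.hasSum
  have h2 := h1.sigma fun M => hasSum_fintype _
  refine hf.hasSum.of_eq (fun _ => rfl) (h.unique (h2.of_eq (fun M => ?_) rfl))
  exact (Finset.sum_coe_sort (HasAntidiagonal.antidiagonal M) f).symm

theorem summable_mul_mul {q : ℂ} (hq : ‖q‖ < 1) {ι : Type*} {c : ι → ℂ}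
    (hc : Summable fun i => ‖c i‖) {C : ℝ} (e : ℕ × ℕ → ℕ) (he : ∀ p, p.1 + p.2 ≤ e p) (v : (ℕ × ℕ) × ι → ℂ)
    (hv : ∀ p, ‖v p‖ ≤ C) :
    Summable fun p : (ℕ × ℕ) × ι => q ^ e p.1 * c p.2 * v p := by
  have hg : Summable fun s : ℕ => ‖q‖ ^ s := summable_geometric_of_lt_one (norm_nonneg q) hq
  have h1 := hg.mul_of_nonneg hg (fun _ => by positivity) (fun _ => by positivity)
  have h2 := h1.mul_of_nonneg hc (fun _ => by positivity) (fun _ => norm_nonneg _)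
  refine (h2.mul_right C).of_norm_bounded fun p => ?_
  rw [norm_mul, norm_mul, norm_pow, ← pow_add]
  refine mul_le_mul (mul_le_mul_of_nonneg_right ?_ (norm_nonneg _)) (hv p) (norm_nonneg _)
    (by positivity)
  exact pow_le_pow_of_le_one (norm_nonneg q) hq.le (he p.1)

/-- The quadratic form in the exponent of the two double series. -/
def expForm (e : ℕ) (p : ℕ × ℕ) : ℕ :=
  (p.1 + p.2) ^ 2 + e * (p.1 + p.2) + p.2 ^ 2 + e * p.2

theorem le_expForm (e : ℕ) (p : ℕ × ℕ) : p.1 + p.2 ≤ expForm e p := by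
  have h := Nat.le_self_pow two_ne_zero (p.1 + p.2)
  unfold expForm
  lia

/-- With M = n + s and d = 2κ + e the exponent is 2(κ^2 + eκ) + M(M + d) + s(s + d), so
q-Chu–Vandermonde sums over s and Cauchy's identity over M. -/
theorem hasSum_bailey_shifted {q : ℂ} (hq : ‖q‖ < 1) (e κ : ℕ) :
    HasSum (fun p : ℕ × ℕ => q ^ expForm e (p.1, p.2 + κ) *
      (qFacInv q p.1 * (qFacInv q p.2 * qFacInv q ((p.2 + (2 * κ + e) : ℕ) : ℤ))))
      (q ^ (2 * (κ ^ 2 + e * κ)) * (qPochInf q q)⁻¹) := by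
  obtain ⟨C, hC0, hC⟩ := exists_norm_qFacInv_le hq
  refine HasSum.antidiagonal ?_ ?_
  · have h := summable_mul_mul hq (c := fun _ : Unit => 1) Summable.of_finite
      (C := C * (C * C)) (fun p => expForm e (p.1, p.2 + κ))
      (fun p => le_trans (by simp) (le_expForm e (p.1, p.2 + κ)))
      (fun p => qFacInv q p.1.1 *
        (qFacInv q p.1.2 * qFacInv q ((p.1.2 + (2 * κ + e) : ℕ) : ℤ)))
      (fun p => by
        rw [norm_mul, norm_mul]
        exact mul_le_mul (hC _) (mul_le_mul (hC _) (hC _) (norm_nonneg _) hC0)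
          (by positivity) hC0)
    simpa [Function.comp_def] using (Equiv.prodPUnit (ℕ × ℕ)).symm.summable_iff.2 h
  · refine ((hasSum_qFacInv_mul_qFacInv hq (2 * κ + e)).mul_left
      (q ^ (2 * (κ ^ 2 + e * κ)))).of_eq (fun M => ?_) rfl
    rw [← sum_antidiagonal_qFacInv hq M (2 * κ + e), Finset.mul_sum, Finset.mul_sum]
    refine Finset.sum_congr rfl fun p hp => ?_
    rw [HasAntidiagonal.mem_antidiagonal] at hp
    rw [← hp, expForm]
    ring

theorem hasSum_bailey_nat {q : ℂ} (hq : ‖q‖ < 1) (e κ : ℕ) :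
    HasSum (fun p : ℕ × ℕ => q ^ expForm e p *
      (qFacInv q p.1 * (qFacInv q (p.2 - κ) * qFacInv q (p.2 + κ + e))))
      (q ^ (2 * (κ ^ 2 + e * κ)) * (qPochInf q q)⁻¹) := by
  have hinj : Function.Injective fun p : ℕ × ℕ => (p.1, p.2 + κ) := by
    rintro ⟨a, b⟩ ⟨c, d⟩ h
    simpa using h
  refine (hinj.hasSum_iff ?_).1 ((hasSum_bailey_shifted hq e κ).of_eq (fun p => ?_) rfl)
  · rintro ⟨a, b⟩ h
    have hb : (b : ℤ) - κ < 0 := by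
      by_contra h1
      exact h ⟨(a, b - κ), by simp; lia⟩
    simp [qFacInv_of_neg q hb]
  · simp only [Function.comp_apply]
    push_cast
    rw [add_sub_cancel_right, show (p.2 : ℤ) + κ + κ + e = p.2 + (2 * κ + e) by ring]

theorem hasSum_bailey {q : ℂ} (hq : ‖q‖ < 1) {e : ℕ} (he : e ≤ 1) (k : ℤ) :
    HasSum (fun p : ℕ × ℕ => q ^ expForm e p *
      (qFacInv q p.1 * (qFacInv q (p.2 + k) * qFacInv q ((p.2 + e : ℕ) - k))))
      (q ^ (2 * (k ^ 2 - e * k).toNat) * (qPochInf q q)⁻¹) := by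
  -- The symmetry k ↦ e - k swaps the two factorials; as e ≤ 1, one of k, e - k has the form -κ.
  obtain ⟨κ, hκ⟩ : ∃ κ : ℕ, k = -κ ∨ k = κ + e := by
    rcases lt_or_ge k e with h | h
    · exact ⟨(-k).toNat, by lia⟩
    · exact ⟨(k - e).toNat, by lia⟩
  have h1 : (k ^ 2 - e * k).toNat = κ ^ 2 + e * κ := by
    have h2 : k ^ 2 - e * k = ((κ ^ 2 + e * κ : ℕ) : ℤ) := by
      push_cast
      rcases hκ with rfl | rfl <;> ring
    rw [h2, Int.toNat_natCast]
  rw [h1]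
  refine (hasSum_bailey_nat hq e κ).of_eq (fun p => ?_) rfl
  push_cast
  rcases hκ with rfl | rfl
  · rw [← sub_eq_add_neg, show (p.2 : ℤ) + e - -κ = p.2 + κ + e by ring]
  · rw [← add_assoc, show (p.2 : ℤ) + e - (κ + e) = p.2 - κ by ring, mul_comm (qFacInv q (_ + _))]

/-- One absolutely convergent triple sum is evaluated in two orders: k innermost by finite Jacobi,
(n, r) innermost by `hasSum_bailey`. -/
theorem hasSum_double_series {q x y S : ℂ} (hq : ‖q‖ < 1) (hx : ‖x‖ < 1) (hy : ‖y‖ < 1)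
    (hxy : x * y = q) {e : ℕ} (he : e ≤ 1)
    (hS : HasSum (fun k : ℤ => thetaTerm x y k * q ^ (2 * (k ^ 2 - e * k).toNat)) S) :
    HasSum (fun p : ℕ × ℕ => q ^ expForm e p * (qPoch x q (p.2 + e) * qPoch y q p.2) /
      (qPoch q q (2 * p.2 + e) * qPoch q q p.1)) (S / qPochInf q q) := by
  obtain ⟨C, hC0, hC⟩ := exists_norm_qFacInv_le hq
  have h := summable_mul_mul hq (summable_norm_thetaTerm hx hy) (C := C * (C * C)) (expForm e)
    (le_expForm e)
    (fun p => qFacInv q p.1.1 * (qFacInv q (p.1.2 + p.2) * qFacInv q ((p.1.2 + e : ℕ) - p.2)))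
    (fun p => by
      rw [norm_mul, norm_mul]
      exact mul_le_mul (hC _) (mul_le_mul (hC _) (hC _) (norm_nonneg _) hC0) (by positivity) hC0)
  have h1 := ((Equiv.prodComm ℤ (ℕ × ℕ)).hasSum_iff.2 h.hasSum).prod_fiberwise fun k =>
    ((hasSum_bailey hq he k).mul_left (thetaTerm x y k)).of_eq
      (fun p => by simp only [Function.comp_apply, Equiv.prodComm_apply, Prod.swap]; ring) rfl
  have h2 := (hS.mul_right (qPochInf q q)⁻¹).unique (h1.of_eq (fun k => by ring) rfl)
  have h3 := h.hasSum.prod_fiberwise fun p =>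
    ((hasSum_finite_jacobi hq hxy (p.2 + e) p.2).mul_left
      (q ^ expForm e p * qFacInv q p.1)).of_eq (fun k => by ring) rfl
  refine h3.of_eq (fun p => ?_) (by rw [div_eq_mul_inv, h2])
  have e1 : ((p.2 + e : ℕ) : ℤ) + p.2 = ((2 * p.2 + e : ℕ) : ℤ) := by push_cast; ring
  rw [e1, qFacInv_natCast, qFacInv_natCast]
  field_simp

/-! ### Specialization to base q^3 and modulus 15. -/

theorem qPoch_three_mul (q : ℂ) (r : ℕ) : qPoch q q (3 * r) =
    qPoch q (q ^ 3) r * qPoch (q ^ 2) (q ^ 3) r * qPoch (q ^ 3) (q ^ 3) r := by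
  induction r with
  | zero => simp [qPoch]
  | succ r ih =>
    rw [show 3 * (r + 1) = 3 * r + 1 + 1 + 1 by ring]
    simp only [qPoch_succ, ih]
    ring

theorem qPoch_three_mul_add_one (q : ℂ) (r : ℕ) : qPoch q q (3 * r + 1) =
    qPoch q (q ^ 3) (r + 1) * qPoch (q ^ 2) (q ^ 3) r * qPoch (q ^ 3) (q ^ 3) r := by
  rw [qPoch_succ, qPoch_succ, qPoch_three_mul]
  ring

theorem hasSum_thetaTerm_mod_fifteen_zero {q : ℂ} (hq : ‖q‖ < 1) :
    HasSum (fun k : ℤ => thetaTerm q (q ^ 2) k * (q ^ 3) ^ (2 * (k ^ 2 - (0 : ℕ) * k).toNat))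
      (qPochInf₃ (q ^ 7) (q ^ 8) (q ^ 15) (q ^ 15)) := by
  have hp : ∀ n : ℕ, n ≠ 0 → ‖q ^ n‖ < 1 := fun n hn => by
    rw [norm_pow]
    exact pow_lt_one₀ (norm_nonneg q) hq hn
  refine (hasSum_jacobi (hp 15 (by lia)) (hp 7 (by lia)) (hp 8 (by lia)) (by ring)).of_eq
    (fun k => ?_) rfl
  have h1 := two_mul_triangular k
  have h2 := two_mul_triangular (k - 1)
  -- The factor q^(6k^2) is shared equally: x = q becomes q^7 and y = q^2 becomes q^8.
  have h3 : (k ^ 2 - (0 : ℕ) * k).toNat = triangular k + triangular (k - 1) := by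
    have h4 : k ^ 2 - (0 : ℕ) * k = ((triangular k + triangular (k - 1) : ℕ) : ℤ) := by
      push_cast
      linarith
    rw [h4, Int.toNat_natCast]
  rw [h3, thetaTerm, thetaTerm]
  ring

theorem hasSum_thetaTerm_mod_fifteen_one {q : ℂ} (hq : ‖q‖ < 1) :
    HasSum (fun k : ℤ => thetaTerm q (q ^ 2) k * (q ^ 3) ^ (2 * (k ^ 2 - (1 : ℕ) * k).toNat))
      (qPochInf₃ q (q ^ 14) (q ^ 15) (q ^ 15)) := by
  have hp : ∀ n : ℕ, n ≠ 0 → ‖q ^ n‖ < 1 := fun n hn => by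
    rw [norm_pow]
    exact pow_lt_one₀ (norm_nonneg q) hq hn
  refine (hasSum_jacobi (hp 15 (by lia)) hq (hp 14 (by lia)) (by ring)).of_eq (fun k => ?_) rfl
  have h2 := two_mul_triangular (k - 1)
  -- Here all of q^(6(k^2-k)) goes to y, turning q^2 into q^14.
  have h3 : (k ^ 2 - (1 : ℕ) * k).toNat = 2 * triangular (k - 1) := by
    have h4 : k ^ 2 - (1 : ℕ) * k = ((2 * triangular (k - 1) : ℕ) : ℤ) := by
      push_cast
      linarith
    rw [h4, Int.toNat_natCast]
  rw [h3, thetaTerm, thetaTerm]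
  ring

theorem mainTheorem3 (q : ℂ) (hq : ‖q‖ < 1) :
    HasSum
      (fun p : ℕ × ℕ =>
        q ^ (3 * p.1 ^ 2 + 6 * p.1 * p.2 + 6 * p.2 ^ 2) * qPoch q q (3 * p.2) /
          (qPoch (q ^ 3) (q ^ 3) (2 * p.2) * qPoch (q ^ 3) (q ^ 3) p.2 *
            qPoch (q ^ 3) (q ^ 3) p.1))
      (qPochInf₃ (q ^ 7) (q ^ 8) (q ^ 15) (q ^ 15) / qPochInf (q ^ 3) (q ^ 3)) ∧
    HasSum
      (fun p : ℕ × ℕ =>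
        q ^ (3 * p.1 ^ 2 + 6 * p.1 * p.2 + 6 * p.2 ^ 2 + 3 * p.1 + 6 * p.2) *
            qPoch q q (3 * p.2 + 1) /
          (qPoch (q ^ 3) (q ^ 3) (2 * p.2 + 1) * qPoch (q ^ 3) (q ^ 3) p.2 *
            qPoch (q ^ 3) (q ^ 3) p.1))
      (qPochInf₃ q (q ^ 14) (q ^ 15) (q ^ 15) / qPochInf (q ^ 3) (q ^ 3)) := by
  have hp : ∀ n : ℕ, n ≠ 0 → ‖q ^ n‖ < 1 := fun n hn => by
    rw [norm_pow]
    exact pow_lt_one₀ (norm_nonneg q) hq hn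
  have hQ := hp 3 (by lia)
  constructor
  · refine (hasSum_double_series hQ hq (hp 2 (by lia)) (by ring) (Nat.zero_le 1)
      (hasSum_thetaTerm_mod_fifteen_zero hq)).of_eq (fun p => ?_) rfl
    have h1 := qPoch_self_ne_zero hQ p.2
    rw [qPoch_three_mul, ← pow_mul, expForm, mul_right_comm _ (qPoch (q ^ 3) (q ^ 3) p.2),
      ← mul_assoc, mul_div_mul_right _ _ h1]
    congr 3
    ring
  · refine (hasSum_double_series hQ hq (hp 2 (by lia)) (by ring) le_rfl
      (hasSum_thetaTerm_mod_fifteen_one hq)).of_eq (fun p => ?_) rfl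
    have h1 := qPoch_self_ne_zero hQ p.2
    rw [qPoch_three_mul_add_one, ← pow_mul, expForm,
      mul_right_comm _ (qPoch (q ^ 3) (q ^ 3) p.2), ← mul_assoc, mul_div_mul_right _ _ h1]
    congr 3
    ring
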